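/- Let $\mathbb{S}^2\subset\mathbb{R}^3$ be the unit sphere and let $\mu$ be its surface (Lebesgue) measure, normalized so that $\mu(\mathbb{S}^2)=1$. A set $S\subseteq\mathbb{S}^2$ is called orthogonal-pair-free if there are no points $p,q\in S$ for which the angle between the rays from the origin through $p$ and $q$ is $\frac{\pi}{2}$. A set $C\subseteq\mathbb{S}^2$ is called convex if for all $x,y\in C$ with $y\neq -x$ it contains the geodesic segment (the shorter great-circle arc) between $x$ and $y$. Two sets $A,B\subseteq\mathbb{S}^2$ are called mutually disjoint if $\mathrm{cl}(A)\cap \mathrm{cl}(B)=\emptyset$. For $k\in\mathbb{N}$ let $\mathcal{A}_k$ be the collection of all orthogonal-pair-free sets $S\subseteq\mathbb{S}^2$ that are a union of at most $k$ pairwise mutually disjoint convex sets. Then for every $k\in\mathbb{N}$ there is a set $M^*_k\in\mathcal{A}_k$ such that $$\mu(M^*_k)=\sup_{S\in\mathcal{A}_k}\mu(S).$$ -/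

import Mathlib

open MeasureTheory

noncomputable section

/-- The unit sphere `𝕊²` of `ℝ³`, centred at the origin. -/
abbrev S2 : Type := Metric.sphere (0 : EuclideanSpace ℝ (Fin 3)) 1

/-- The surface (Lebesgue) measure on the sphere, normalized to total mass `1`. -/
def sphereMeasure : Measure S2 :=
  ((volume : Measure (EuclideanSpace ℝ (Fin 3))).toSphere Set.univ)⁻¹ •
    (volume : Measure (EuclideanSpace ℝ (Fin 3))).toSphere

/-- Two points form an orthogonal pair if the angle between the rays from the origin through
them is `π / 2`. -/
def IsOrthogonalPair (p q : S2) : Prop :=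
  InnerProductGeometry.angle (p : EuclideanSpace ℝ (Fin 3)) (q : EuclideanSpace ℝ (Fin 3)) =
    Real.pi / 2

/-- A set without orthogonal pairs. -/
def OrthogonalPairFree (A : Set S2) : Prop :=
  ∀ p ∈ A, ∀ q ∈ A, ¬ IsOrthogonalPair p q

/-- For `y ≠ -x`, the geodesic segment between `x` and `y`, that is, the shorter arc of the great
circle through `x` and `y`: the points of the sphere in the convex cone spanned by `x` and `y`. -/
def geodesicSegment (x y : S2) : Set S2 :=
  {z | ∃ a b : ℝ, 0 ≤ a ∧ 0 ≤ b ∧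
    (z : EuclideanSpace ℝ (Fin 3)) =
      a • (x : EuclideanSpace ℝ (Fin 3)) + b • (y : EuclideanSpace ℝ (Fin 3))}

/-- Spherical convexity: the set contains the geodesic segment between any two of its
non-antipodal points. -/
def SphericallyConvex (C : Set S2) : Prop :=
  ∀ x ∈ C, ∀ y ∈ C, y ≠ -x → geodesicSegment x y ⊆ C

/-- Two sets are mutually disjoint if their closures are disjoint. -/
def MutuallyDisjoint (A B : Set S2) : Prop :=
  closure A ∩ closure B = ∅

/-- The class `𝒜_k` of orthogonal-pair-free sets that consist of at most `k` mutually disjoint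
convex sets. -/
def convexClass (k : ℕ) : Set (Set S2) :=
  {S | OrthogonalPairFree S ∧
    ∃ n : ℕ, n ≤ k ∧ ∃ C : Fin n → Set S2,
      (∀ i, SphericallyConvex (C i)) ∧
      (∀ i j, i ≠ j → MutuallyDisjoint (C i) (C j)) ∧
      S = ⋃ i, C i}

end

/-!
In a convex orthogonal-pair-free set, non-antipodal points have positive inner product, because a
great-circle arc joining `x` to a point `y` with `⟪x, y⟫ < 0` contains a point orthogonal to `x`; so
such a set contains an antipodal pair only if it is null. By the same argument, the inner products
between two pieces of an orthogonal-pair-free union have constant sign, and the pieces give rise to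
a symmetric sign matrix `σ` with unit diagonal. These weak sign conditions pass to closures. The
families of compact sets satisfying them for some `σ` form a compact set in the Vietoris topology,
on which the measure of the union is upper semicontinuous, so this measure is maximal for some
family `F`.

To return to the original class, drop the null members of `F` and merge those with equal rows of
`σ`; the sign conditions survive merging. The interiors of the cones generated by the merged sets
satisfy the sign conditions strictly, so their traces on the sphere form an orthogonal-pair-free
family of convex sets, and only a null set is lost. Their closures are disjoint: if the rows of two
of them differ at `l`, a common point of the closures is orthogonal to all of `F l`, which is not
null.
-/

open Filter Metric Module Set TopologicalSpace
open scoped InnerProductSpace Pointwise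

noncomputable section

section Cone

variable {E : Type*} [AddCommGroup E] [Module ℝ E] {K : PointedCone ℝ E} {t : ℝ} {x y : E}

theorem image_smul_pointedCone (K : PointedCone ℝ E) (ht : 0 < t) :
    (t • ·) '' (K : Set E) = K :=
  (image_subset_iff.2 fun _ hx => K.smul_mem ht.le hx).antisymm fun x hx =>
    ⟨t⁻¹ • x, K.smul_mem (inv_pos.2 ht).le hx, smul_inv_smul₀ ht.ne' x⟩

variable [TopologicalSpace E]

theorem add_mem_interior_pointedCone [ContinuousAdd E] (hx : x ∈ interior (K : Set E))
    (hy : y ∈ K) : x + y ∈ interior (K : Set E) :=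
  interior_mono (add_subset_iff.2 fun _ ha _ hb => K.add_mem ha hb)
    (subset_interior_add_left (add_mem_add hx hy))

variable [ContinuousConstSMul ℝ E]

theorem smul_mem_interior_pointedCone (ht : 0 < t) (hx : x ∈ interior (K : Set E)) :
    t • x ∈ interior (K : Set E) := by
  have h := (Homeomorph.smulOfNeZero t ht.ne').image_interior (K : Set E)
  rw [Homeomorph.smulOfNeZero_apply, image_smul_pointedCone K ht] at h
  exact h ▸ mem_image_of_mem _ hx

theorem smul_mem_frontier_pointedCone (ht : 0 < t) (hx : x ∈ frontier (K : Set E)) :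
    t • x ∈ frontier (K : Set E) := by
  have h := (Homeomorph.smulOfNeZero t ht.ne').image_frontier (K : Set E)
  rw [Homeomorph.smulOfNeZero_apply, image_smul_pointedCone K ht] at h
  exact h ▸ mem_image_of_mem _ hx

end Cone

section SphereMeasure

theorem iUnion_ae_le_iUnion_ne_zero {α ι : Type*} [MeasurableSpace α] [Countable ι] (μ : Measure α)
    (F : ι → Set α) :
    (⋃ i, F i : Set α) ≤ᵐ[μ] (⋃ i : {i // μ (F i) ≠ 0}, F i : Set α) := by
  have hle (i : ι) : F i ≤ᵐ[μ] (⋃ i : {i // μ (F i) ≠ 0}, F i : Set α) := by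
    by_cases hi : μ (F i) = 0
    · exact ae_le_set.2 (measure_mono_null sdiff_subset hi)
    · exact (subset_iUnion (fun i : {i // μ (F i) ≠ 0} => F i) ⟨i, hi⟩).eventuallyLE
  exact (Filter.EventuallyLE.countable_iUnion hle).trans
    (iUnion_subset fun _ => Subset.rfl).eventuallyLE

variable {E : Type*} [NormedAddCommGroup E] [NormedSpace ℝ E] [MeasurableSpace E] [BorelSpace E]

theorem toSphere_preimage_eq_zero {ν : Measure E} {N : Set E} (hN : MeasurableSet N)
    (hν : ν N = 0) (hcone : ∀ t : ℝ, 0 < t → ∀ x ∈ N, t • x ∈ N) :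
    ν.toSphere ((↑) ⁻¹' N) = 0 := by
  rw [Measure.toSphere_apply' _ (measurable_subtype_coe hN), measure_mono_null _ hν, mul_zero]
  rintro _ ⟨t, ht, _, ⟨x, hx, rfl⟩, rfl⟩
  exact hcone t ht.1 _ hx

variable [FiniteDimensional ℝ E] (ν : Measure E) [ν.IsAddHaarMeasure]

theorem toSphere_preimage_submodule {V : Submodule ℝ E} (hV : V ≠ ⊤) :
    ν.toSphere ((↑) ⁻¹' (V : Set E)) = 0 :=
  toSphere_preimage_eq_zero V.closed_of_finiteDimensional.measurableSet
    (Measure.addHaar_submodule ν V hV) fun t _ _ hx => V.smul_mem t hx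

theorem toSphere_preimage_frontier_pointedCone (K : PointedCone ℝ E) :
    ν.toSphere ((↑) ⁻¹' frontier (K : Set E)) = 0 :=
  toSphere_preimage_eq_zero isClosed_frontier.measurableSet (K.convex.addHaar_frontier ν)
    fun _ ht _ hx => smul_mem_frontier_pointedCone ht hx

theorem toSphere_antipodal_pair (hE : 1 < finrank ℝ E) (x : sphere (0 : E) 1) :
    ν.toSphere {x, -x} = 0 := by
  have hV : Submodule.span ℝ {(x : E)} ≠ ⊤ := fun h => by
    have := finrank_span_singleton (K := ℝ) (ne_zero_of_mem_unit_sphere x)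
    rw [h, finrank_top] at this
    exact hE.ne' this
  refine measure_mono_null ?_ (toSphere_preimage_submodule ν hV)
  rintro y (rfl | rfl)
  · exact Submodule.mem_span_singleton_self _
  · exact neg_mem (Submodule.mem_span_singleton_self _)

end SphereMeasure

variable {E : Type*} [NormedAddCommGroup E] [InnerProductSpace ℝ E]

theorem toSphere_eq_zero_of_inner_eq_zero [FiniteDimensional ℝ E] [MeasurableSpace E]
    [BorelSpace E] (ν : Measure E) [ν.IsAddHaarMeasure] {A : Set (sphere (0 : E) 1)} {v : E}
    (hv : v ≠ 0) (hA : ∀ x ∈ A, ⟪v, x⟫_ℝ = 0) : ν.toSphere A = 0 := by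
  have hV : (ℝ ∙ v)ᗮ ≠ ⊤ := fun h => hv <| by
    rwa [Submodule.orthogonal_eq_top_iff, Submodule.span_singleton_eq_bot] at h
  have hsub : A ⊆ (↑) ⁻¹' ((ℝ ∙ v)ᗮ : Set E) := fun x hx =>
    Submodule.mem_orthogonal_singleton_iff_inner_right.2 (hA x hx)
  exact measure_mono_null hsub (toSphere_preimage_submodule ν hV)

/-- Convexity on the unit sphere of any real inner product space, in the sense of
`SphericallyConvex`. -/
def GeodesicallyConvex (C : Set (sphere (0 : E) 1)) : Prop :=
  ∀ x ∈ C, ∀ y ∈ C, y ≠ -x →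
    {z : sphere (0 : E) 1 | ∃ a b : ℝ, 0 ≤ a ∧ 0 ≤ b ∧ (z : E) = a • (x : E) + b • (y : E)} ⊆ C

/-- Absence of orthogonal pairs on the unit sphere of any real inner product space, expressed
through inner products instead of angles. -/
def OrthogonalFree (A : Set (sphere (0 : E) 1)) : Prop :=
  ∀ p ∈ A, ∀ q ∈ A, ⟪(p : E), q⟫_ℝ ≠ 0

variable (E) in
/-- The orthogonal-pair-free unions of convex sets with disjoint closures, for any unit sphere. The
pieces are indexed by `ι`, and pieces may be empty, so there are at most `Nat.card ι` of them if `ι`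
is finite. -/
def orthogonalFreeUnions (ι : Type*) : Set (Set (sphere (0 : E) 1)) :=
  {S | OrthogonalFree S ∧ ∃ C : ι → Set (sphere (0 : E) 1), (∀ i, GeodesicallyConvex (C i)) ∧
    (Pairwise fun i j => Disjoint (closure (C i)) (closure (C j))) ∧ S = ⋃ i, C i}

theorem OrthogonalFree.mono {A B : Set (sphere (0 : E) 1)} (hB : OrthogonalFree B) (h : A ⊆ B) :
    OrthogonalFree A :=
  fun p hp q hq => hB p (h hp) q (h hq)

theorem orthogonalFreeUnions_subset_of_injective {ι κ : Type*} {e : κ → ι}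
    (he : Function.Injective e) : orthogonalFreeUnions E κ ⊆ orthogonalFreeUnions E ι := by
  rintro _ ⟨hfree, C, hconv, hdisj, rfl⟩
  have hextend (i : ι) : (∃ k, e k = i ∧ Function.extend e C ⊥ i = C k) ∨
      Function.extend e C ⊥ i = ∅ := by
    by_cases h : ∃ k, e k = i
    · obtain ⟨k, rfl⟩ := h
      exact Or.inl ⟨k, rfl, he.extend_apply C ⊥ k⟩
    · exact Or.inr (Function.extend_apply' C ⊥ i h)
  refine ⟨hfree, Function.extend e C ⊥, fun i => ?_, fun i j hij => ?_,
    (iSup_extend_bot he C).symm⟩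
  · obtain ⟨k, -, h⟩ | h := hextend i
    · exact h ▸ hconv k
    · exact h ▸ fun x hx => hx.elim
  · obtain ⟨k, rfl, hk⟩ | hi := hextend i
    · obtain ⟨l, rfl, hl⟩ | hj := hextend j
      · rw [hk, hl]
        exact hdisj fun h => hij (congrArg e h)
      · simp only [hj, closure_empty, disjoint_empty]
    · simp only [hi, closure_empty, empty_disjoint]

section InnerSign

/-- `HasInnerSign c A B` says that the inner products between points of `A` and points of `B` are
all nonnegative if `c = 1`, and all nonpositive if `c = -1`. -/
def HasInnerSign (c : ℤˣ) (A B : Set (sphere (0 : E) 1)) : Prop :=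
  ∀ x ∈ A, ∀ y ∈ B, 0 ≤ ((c : ℤ) : ℝ) * ⟪(x : E), y⟫_ℝ

variable {c : ℤˣ} {A B : Set (sphere (0 : E) 1)}

theorem HasInnerSign.symm (h : HasInnerSign c A B) : HasInnerSign c B A :=
  fun x hx y hy => real_inner_comm (x : E) y ▸ h y hy x hx

theorem hasInnerSign_iff_prod_subset :
    HasInnerSign c A B ↔
      A ×ˢ B ⊆ {p : sphere (0 : E) 1 × sphere (0 : E) 1 |
        0 ≤ ((c : ℤ) : ℝ) * ⟪(p.1 : E), p.2⟫_ℝ} :=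
  ⟨fun h p hp => h p.1 hp.1 p.2 hp.2, fun h _ hx _ hy => h (mk_mem_prod hx hy)⟩

theorem isClosed_setOf_mul_inner_nonneg (a : ℝ) :
    IsClosed {p : sphere (0 : E) 1 × sphere (0 : E) 1 | 0 ≤ a * ⟪(p.1 : E), p.2⟫_ℝ} :=
  isClosed_le (by fun_prop) (by fun_prop)

protected theorem HasInnerSign.closure (h : HasInnerSign c A B) :
    HasInnerSign c (closure A) (closure B) := by
  rw [hasInnerSign_iff_prod_subset] at h ⊢
  rw [← closure_prod_eq]
  exact closure_minimal h (isClosed_setOf_mul_inner_nonneg _)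

theorem isClosed_setOf_hasInnerSign (c : ℤˣ) :
    IsClosed {p : Compacts (sphere (0 : E) 1) × Compacts (sphere (0 : E) 1) |
      HasInnerSign c (p.1 : Set (sphere (0 : E) 1)) p.2} := by
  simp only [hasInnerSign_iff_prod_subset]
  exact (Compacts.isClosed_subsets_of_isClosed (isClosed_setOf_mul_inner_nonneg _)).preimage
    Compacts.continuous_prod

end InnerSign

section Convex

variable {C D : Set (sphere (0 : E) 1)}

theorem smul_add_smul_ne_zero_of_ne_neg {x y : sphere (0 : E) 1} (hyx : y ≠ -x) {a b : ℝ}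
    (ha : 0 < a) (hb : 0 < b) : a • (x : E) + b • (y : E) ≠ 0 := by
  intro h
  have hray : SameRay ℝ (y : E) (-x : E) :=
    Or.inr (Or.inr ⟨b, a, hb, ha, by rw [smul_neg]; exact eq_neg_of_add_eq_zero_right h⟩)
  exact hyx (Subtype.ext ((sameRay_iff_of_norm_eq (by simp)).1 hray))

theorem GeodesicallyConvex.exists_inner_eq_zero (hC : GeodesicallyConvex C) {v : E}
    {x y : sphere (0 : E) 1} (hx : x ∈ C) (hy : y ∈ C) (hyx : y ≠ -x) (hvx : 0 < ⟪v, x⟫_ℝ)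
    (hvy : ⟪v, y⟫_ℝ < 0) : ∃ w ∈ C, ⟪v, w⟫_ℝ = 0 := by
  set a := -⟪v, y⟫_ℝ with ha
  set b := ⟪v, x⟫_ℝ with hb
  have ha0 : 0 < a := neg_pos.2 hvy
  set u : E := a • (x : E) + b • (y : E) with hu
  have hu0 : u ≠ 0 := smul_add_smul_ne_zero_of_ne_neg hyx ha0 hvx
  have huv : ⟪v, u⟫_ℝ = 0 := by
    rw [hu, inner_add_right, real_inner_smul_right, real_inner_smul_right, ← hb, ha]
    ring
  refine ⟨⟨‖u‖⁻¹ • u, by simp [norm_smul, hu0]⟩, hC x hx y hy hyx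
    ⟨‖u‖⁻¹ * a, ‖u‖⁻¹ * b, by positivity, by positivity, ?_⟩, ?_⟩
  · simp only [hu, smul_add, smul_smul]
  · rw [real_inner_smul_right, huv, mul_zero]

theorem GeodesicallyConvex.inner_mul_inner_pos (hC : GeodesicallyConvex C) {v : E}
    (hv : ∀ w ∈ C, ⟪v, w⟫_ℝ ≠ 0) {x y : sphere (0 : E) 1} (hx : x ∈ C) (hy : y ∈ C)
    (hyx : y ≠ -x) : 0 < ⟪v, x⟫_ℝ * ⟪v, y⟫_ℝ := by
  by_contra! h
  rcases mul_neg_iff.1 (h.lt_of_ne (mul_ne_zero (hv x hx) (hv y hy))) with ⟨h1, h2⟩ | ⟨h1, h2⟩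
  · obtain ⟨w, hw, h0⟩ := hC.exists_inner_eq_zero hx hy hyx h1 h2
    exact hv w hw h0
  · have hxy : x ≠ -y := fun h => hyx (neg_eq_iff_eq_neg.1 h.symm)
    obtain ⟨w, hw, h0⟩ := hC.exists_inner_eq_zero hy hx hxy h2 h1
    exact hv w hw h0

theorem GeodesicallyConvex.inner_pos (hC : GeodesicallyConvex C) (hfree : OrthogonalFree C)
    {x y : sphere (0 : E) 1} (hx : x ∈ C) (hy : y ∈ C) (hyx : y ≠ -x) : 0 < ⟪(x : E), y⟫_ℝ := by
  simpa using hC.inner_mul_inner_pos (hfree x hx) hx hy hyx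

theorem GeodesicallyConvex.subset_antipodal_pair (hC : GeodesicallyConvex C)
    (hfree : OrthogonalFree C) {x : sphere (0 : E) 1} (hx : x ∈ C) (hx' : -x ∈ C) :
    C ⊆ {x, -x} := by
  intro y hy
  by_contra! hne
  simp only [mem_insert_iff, mem_singleton_iff, not_or] at hne
  have hpos := hC.inner_pos hfree hx hy hne.2
  have hneg := hC.inner_pos hfree hx' hy (by simpa using hne.1)
  rw [coe_neg_sphere, inner_neg_left] at hneg
  linarith

theorem GeodesicallyConvex.hasInnerSign_self (hC : GeodesicallyConvex C)
    (hfree : OrthogonalFree C) : HasInnerSign 1 (C \ -C) (C \ -C) := by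
  rintro x hx y hy
  have hyx : y ≠ -x := fun h => hy.2 (by simpa [h] using hx.1)
  simpa using (hC.inner_pos hfree hx.1 hy.1 hyx).le

theorem GeodesicallyConvex.exists_hasInnerSign (hC : GeodesicallyConvex C)
    (hD : GeodesicallyConvex D) (hCD : ∀ x ∈ C, ∀ y ∈ D, ⟪(x : E), y⟫_ℝ ≠ 0) :
    ∃ c, HasInnerSign c (C \ -C) (D \ -D) := by
  have hne {B : Set (sphere (0 : E) 1)} {x y} (hx : x ∈ B \ -B) (hy : y ∈ B \ -B) : y ≠ -x :=
    fun h => hy.2 (by simpa [h] using hx.1)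
  have hsame {x x' y y' : sphere (0 : E) 1} (hx : x ∈ C \ -C) (hx' : x' ∈ C \ -C)
      (hy : y ∈ D \ -D) (hy' : y' ∈ D \ -D) (h : 0 < ⟪(x : E), y⟫_ℝ) : 0 < ⟪(x' : E), y'⟫_ℝ := by
    have hxy' := pos_of_mul_pos_right
      (hD.inner_mul_inner_pos (hCD x hx.1) hy.1 hy'.1 (hne hy hy')) h.le
    rw [real_inner_comm] at hxy' ⊢
    exact pos_of_mul_pos_right (hC.inner_mul_inner_pos
      (fun w hw => real_inner_comm (y' : E) w ▸ hCD w hw y' hy'.1) hx.1 hx'.1 (hne hx hx')) hxy'.le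
  by_cases h : ∃ x ∈ C \ -C, ∃ y ∈ D \ -D, 0 < ⟪(x : E), y⟫_ℝ
  · obtain ⟨x, hx, y, hy, hxy⟩ := h
    exact ⟨1, fun x' hx' y' hy' => by simpa using (hsame hx hx' hy hy' hxy).le⟩
  · push Not at h
    exact ⟨-1, fun x hx y hy => by simpa using h x hx y hy⟩

theorem GeodesicallyConvex.toSphere_inter_neg [FiniteDimensional ℝ E] [MeasurableSpace E]
    [BorelSpace E] (ν : Measure E) [ν.IsAddHaarMeasure] (hE : 1 < finrank ℝ E)
    (hC : GeodesicallyConvex C) (hfree : OrthogonalFree C) : ν.toSphere (C ∩ -C) = 0 := by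
  obtain h | ⟨x, hx, hx'⟩ := (C ∩ -C).eq_empty_or_nonempty
  · rw [h, measure_empty]
  · exact measure_mono_null (inter_subset_left.trans (hC.subset_antipodal_pair hfree hx hx'))
      (toSphere_antipodal_pair ν hE x)

end Convex

section SignMatrix

variable {ι : Type*}

/-- A symmetric matrix of signs with unit diagonal whose entries prescribe the signs of the inner
products within and between the members of the family `F`. -/
structure IsSignMatrix (σ : ι → ι → ℤˣ) (F : ι → Set (sphere (0 : E) 1)) : Prop where
  symm : ∀ i j, σ i j = σ j i
  diag : ∀ i, σ i i = 1
  hasInnerSign : ∀ i j, HasInnerSign (σ i j) (F i) (F j)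

protected theorem IsSignMatrix.closure {σ : ι → ι → ℤˣ} {F : ι → Set (sphere (0 : E) 1)}
    (h : IsSignMatrix σ F) : IsSignMatrix σ fun i => closure (F i) :=
  ⟨h.symm, h.diag, fun i j => (h.hasInnerSign i j).closure⟩

theorem IsSignMatrix.comp {κ : Type*} {σ : ι → ι → ℤˣ} {F : ι → Set (sphere (0 : E) 1)}
    (h : IsSignMatrix σ F) (e : κ → ι) : IsSignMatrix (fun i j => σ (e i) (e j)) (F ∘ e) :=
  ⟨fun _ _ => h.symm _ _, fun _ => h.diag _, fun _ _ => h.hasInnerSign _ _⟩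

open Classical in
theorem exists_isSignMatrix {F : ι → Set (sphere (0 : E) 1)}
    (hself : ∀ i, HasInnerSign 1 (F i) (F i)) (hpair : ∀ i j, ∃ c, HasInnerSign c (F i) (F j)) :
    ∃ σ, IsSignMatrix σ F := by
  refine ⟨fun i j => if HasInnerSign 1 (F i) (F j) then 1 else -1, fun i j => ?_,
    fun i => if_pos (hself i), fun i j => ?_⟩
  · simp only [show HasInnerSign 1 (F i) (F j) ↔ HasInnerSign 1 (F j) (F i) from
      ⟨HasInnerSign.symm, HasInnerSign.symm⟩]
  · split_ifs with h
    · exact h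
    · obtain ⟨c, hc⟩ := hpair i j
      obtain rfl | rfl := Int.units_eq_one_or c
      exacts [(h hc).elim, hc]

variable (E ι) in
/-- The families of compact subsets of the unit sphere that admit a sign matrix. -/
def signedCompacts : Set (ι → Compacts (sphere (0 : E) 1)) :=
  {F | ∃ σ, IsSignMatrix σ fun i => (F i : Set (sphere (0 : E) 1))}

theorem exists_mem_signedCompacts_ae_le [Countable ι] [FiniteDimensional ℝ E] [MeasurableSpace E]
    [BorelSpace E] (ν : Measure E) [ν.IsAddHaarMeasure] (hE : 1 < finrank ℝ E)
    {S : Set (sphere (0 : E) 1)} (hS : S ∈ orthogonalFreeUnions E ι) :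
    ∃ F ∈ signedCompacts E ι, S ≤ᵐ[ν.toSphere] (⋃ i, F i : Set (sphere (0 : E) 1)) := by
  obtain ⟨hfree, C, hconv, -, rfl⟩ := hS
  have hsub := subset_iUnion C
  obtain ⟨σ, hσ⟩ := exists_isSignMatrix (F := fun i => C i \ -C i)
    (fun i => (hconv i).hasInnerSign_self (hfree.mono (hsub i)))
    fun i j => (hconv i).exists_hasInnerSign (hconv j)
      fun x hx y hy => hfree x (hsub i hx) y (hsub j hy)
  refine ⟨fun i => ⟨closure (C i \ -C i), isClosed_closure.isCompact⟩, ⟨σ, hσ.closure⟩,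
    Filter.EventuallyLE.countable_iUnion fun i => ae_le_set.2 (measure_mono_null ?_
      ((hconv i).toSphere_inter_neg ν hE (hfree.mono (hsub i))))⟩
  exact fun x hx => ⟨hx.1, by_contra fun h => hx.2 (subset_closure ⟨hx.1, h⟩)⟩

end SignMatrix

section Compactness

theorem upperSemicontinuous_measure_iUnion_compacts {ι X : Type*} [Finite ι] [TopologicalSpace X]
    [MeasurableSpace X] (μ : Measure X) [μ.OuterRegular] :
    UpperSemicontinuous fun F : ι → Compacts X => μ (⋃ i, F i) := by
  intro F c hc
  obtain ⟨U, hFU, hU, hUc⟩ := Set.exists_isOpen_lt_of_lt _ c hc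
  have hsub : ∀ᶠ G in nhds F, ∀ i, (G i : Set X) ⊆ U := eventually_all.2 fun i =>
    (continuous_apply i).continuousAt.eventually
      ((Compacts.isOpen_subsets_of_isOpen hU).mem_nhds ((subset_iUnion _ i).trans hFU))
  filter_upwards [hsub] with G hG
  exact (measure_mono (iUnion_subset hG)).trans_lt hUc

variable {ι : Type*} [Finite ι]

theorem isClosed_signedCompacts : IsClosed (signedCompacts E ι) := by
  have hunion : signedCompacts E ι =
      ⋃ σ ∈ {σ : ι → ι → ℤˣ | (∀ i j, σ i j = σ j i) ∧ ∀ i, σ i i = 1},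
        ⋂ i, ⋂ j, {F | HasInnerSign (σ i j) (F i : Set (sphere (0 : E) 1)) (F j)} := by
    ext F
    simp only [signedCompacts, mem_ofPred_eq, mem_iUnion, mem_iInter, exists_prop]
    exact ⟨fun ⟨σ, h⟩ => ⟨σ, ⟨h.symm, h.diag⟩, h.hasInnerSign⟩,
      fun ⟨σ, ⟨hsymm, hdiag⟩, h⟩ => ⟨σ, hsymm, hdiag, h⟩⟩
  rw [hunion]
  exact (toFinite _).isClosed_biUnion fun σ _ => isClosed_iInter fun i => isClosed_iInter fun j =>
    (isClosed_setOf_hasInnerSign (σ i j)).preimage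
      (f := fun F : ι → Compacts (sphere (0 : E) 1) => (F i, F j)) (by fun_prop)

theorem exists_isMaxOn_signedCompacts [FiniteDimensional ℝ E] [MeasurableSpace E] [BorelSpace E]
    (μ : Measure (sphere (0 : E) 1)) [IsFiniteMeasure μ] :
    ∃ F ∈ signedCompacts E ι, IsMaxOn (fun F => μ (⋃ i, F i)) (signedCompacts E ι) F :=
  UpperSemicontinuousOn.exists_isMaxOn
    ⟨⊥, 1, fun _ _ => rfl, fun _ => rfl, fun _ _ _ hx => hx.elim⟩
    isClosed_signedCompacts.isCompact
    ((upperSemicontinuous_measure_iUnion_compacts μ).upperSemicontinuousOn _)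

end Compactness

section OpenHull

/-- The points of the sphere in the interior of the convex cone generated by `A`. Passing to the
interior makes the inequalities of `HasInnerSign` strict, and loses only a null subset of `A`. -/
def openHull (A : Set (sphere (0 : E) 1)) : Set (sphere (0 : E) 1) :=
  (↑) ⁻¹' interior (PointedCone.hull ℝ ((↑) '' A : Set E) : Set E)

variable {c : ℤˣ} {A B : Set (sphere (0 : E) 1)}

theorem geodesicallyConvex_openHull (A : Set (sphere (0 : E) 1)) :
    GeodesicallyConvex (openHull A) := by
  rintro x hx y hy - z ⟨a, b, ha, hb, hz⟩
  rw [openHull, mem_preimage, hz]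
  rcases ha.lt_or_eq with ha | rfl
  · exact add_mem_interior_pointedCone (smul_mem_interior_pointedCone ha hx)
      (PointedCone.smul_mem _ hb (interior_subset hy))
  · have hb0 : b ≠ 0 := by
      rintro rfl
      exact ne_zero_of_mem_unit_sphere z (by simpa using hz)
    rw [zero_smul, zero_add]
    exact smul_mem_interior_pointedCone (hb.lt_of_ne' hb0) hy

theorem ae_le_openHull [FiniteDimensional ℝ E] [MeasurableSpace E] [BorelSpace E] (ν : Measure E)
    [ν.IsAddHaarMeasure] (A : Set (sphere (0 : E) 1)) : A ≤ᵐ[ν.toSphere] openHull A := by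
  have hsub : A \ openHull A ⊆ (↑) ⁻¹' frontier (PointedCone.hull ℝ ((↑) '' A : Set E) : Set E) :=
    fun x hx => ⟨subset_closure (PointedCone.subset_hull (mem_image_of_mem _ hx.1)), hx.2⟩
  exact ae_le_set.2 (measure_mono_null hsub (toSphere_preimage_frontier_pointedCone ν _))

theorem inner_nonneg_of_mem_hull {v y : E} {s : Set E} (h : ∀ x ∈ s, 0 ≤ ⟪v, x⟫_ℝ)
    (hy : y ∈ PointedCone.hull ℝ s) : 0 ≤ ⟪v, y⟫_ℝ := by
  have hle : PointedCone.hull ℝ s ≤ PointedCone.dual (innerₗ E) {v} :=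
    Submodule.span_le.2 fun x hx => by simpa using h x hx
  simpa using hle hy

theorem inner_pos_of_mem_interior {s : Set E} {v x : E} (hv : v ≠ 0)
    (h : ∀ z ∈ s, 0 ≤ ⟪v, z⟫_ℝ) (hx : x ∈ interior s) : 0 < ⟪v, x⟫_ℝ := by
  have hopen : IsOpenMap (innerSL ℝ v) :=
    (innerSL ℝ v).isOpenMap_of_ne_zero fun h => hv (by simpa using DFunLike.congr_fun h v)
  have himage : innerSL ℝ v '' interior s ⊆ Ioi 0 := by
    rw [← interior_Ici]
    exact interior_maximal (image_subset_iff.2 fun z hz => h z (interior_subset hz))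
      (hopen _ isOpen_interior)
  exact himage (mem_image_of_mem _ hx)

theorem HasInnerSign.openHull_right (h : HasInnerSign c A B) : HasInnerSign c A (openHull B) := by
  intro x hx y hy
  rw [← real_inner_smul_left]
  refine inner_nonneg_of_mem_hull ?_ (interior_subset hy)
  rintro _ ⟨z, hz, rfl⟩
  exact real_inner_smul_left (x : E) z _ ▸ h x hx z hz

theorem HasInnerSign.inner_openHull_ne_zero (h : HasInnerSign c A B) {p q : sphere (0 : E) 1}
    (hp : p ∈ openHull A) (hq : q ∈ openHull B) : ⟪(p : E), q⟫_ℝ ≠ 0 := by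
  have hc : ((c : ℤ) : ℝ) ≠ 0 := Int.cast_ne_zero.2 c.ne_zero
  have hq0 : ((c : ℤ) : ℝ) • (q : E) ≠ 0 := smul_ne_zero hc (ne_zero_of_mem_unit_sphere q)
  have hnonneg : ∀ y ∈ (PointedCone.hull ℝ ((↑) '' A : Set E) : Set E),
      0 ≤ ⟪((c : ℤ) : ℝ) • (q : E), y⟫_ℝ := by
    refine fun y hy => inner_nonneg_of_mem_hull ?_ hy
    rintro _ ⟨x, hx, rfl⟩
    exact real_inner_smul_left (q : E) x _ ▸ h.openHull_right.symm q hq x hx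
  have hpos := inner_pos_of_mem_interior hq0 hnonneg hp
  rw [real_inner_smul_left, real_inner_comm] at hpos
  exact right_ne_zero_of_mul hpos.ne'

theorem HasInnerSign.disjoint_closure_openHull [FiniteDimensional ℝ E] [MeasurableSpace E]
    [BorelSpace E] (ν : Measure E) [ν.IsAddHaarMeasure] {L : Set (sphere (0 : E) 1)}
    (hL : ν.toSphere L ≠ 0) (hA : HasInnerSign c A L) (hB : HasInnerSign (-c) B L) :
    Disjoint (closure (openHull A)) (closure (openHull B)) := by
  refine disjoint_left.2 fun p hpA hpB => hL ?_
  refine toSphere_eq_zero_of_inner_eq_zero ν (ne_zero_of_mem_unit_sphere p) fun x hx => ?_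
  have hA' := hA.symm.openHull_right.closure x (subset_closure hx) p hpA
  have hB' := hB.symm.openHull_right.closure x (subset_closure hx) p hpB
  rw [real_inner_comm] at hA' hB'
  obtain rfl | rfl := Int.units_eq_one_or c
  all_goals
    push_cast at hA' hB'
    linarith

end OpenHull

section RowUnion

variable {ι : Type*} {σ : ι → ι → ℤˣ} {F : ι → Set (sphere (0 : E) 1)}

/-- The union of the members of the family `F` whose row in the sign matrix `σ` is `r`. -/
def rowUnion (σ : ι → ι → ℤˣ) (F : ι → Set (sphere (0 : E) 1)) (r : ι → ℤˣ) :
    Set (sphere (0 : E) 1) :=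
  ⋃ (i) (_ : σ i = r), F i

theorem IsSignMatrix.hasInnerSign_rowUnion_left (h : IsSignMatrix σ F) (i l : ι) :
    HasInnerSign (σ i l) (rowUnion σ F (σ i)) (F l) := by
  intro x hx y hy
  obtain ⟨i', hi', hx⟩ := mem_iUnion₂.1 hx
  exact congrFun hi' l ▸ h.hasInnerSign i' l x hx y hy

theorem IsSignMatrix.hasInnerSign_rowUnion (h : IsSignMatrix σ F) (i j : ι) :
    HasInnerSign (σ i j) (rowUnion σ F (σ i)) (rowUnion σ F (σ j)) := by
  intro x hx y hy
  obtain ⟨j', hj', hy⟩ := mem_iUnion₂.1 hy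
  have hσ : σ i j' = σ i j := by rw [h.symm i j', hj', h.symm j i]
  exact hσ ▸ h.hasInnerSign_rowUnion_left i j' x hx y hy

variable [FiniteDimensional ℝ E] [MeasurableSpace E] [BorelSpace E] (ν : Measure E)
  [ν.IsAddHaarMeasure]

theorem IsSignMatrix.disjoint_closure_openHull_rowUnion (h : IsSignMatrix σ F)
    (hF : ∀ i, ν.toSphere (F i) ≠ 0) {i j : ι} (hij : σ i ≠ σ j) :
    Disjoint (closure (openHull (rowUnion σ F (σ i))))
      (closure (openHull (rowUnion σ F (σ j)))) := by
  obtain ⟨l, hl⟩ := Function.ne_iff.1 hij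
  have hneg : σ j l = -σ i l := Int.units_ne_iff_eq_neg.1 hl.symm
  exact (h.hasInnerSign_rowUnion_left i l).disjoint_closure_openHull ν (hF l)
    (hneg ▸ h.hasInnerSign_rowUnion_left j l)

theorem IsSignMatrix.iUnion_openHull_rowUnion_mem (h : IsSignMatrix σ F)
    (hF : ∀ i, ν.toSphere (F i) ≠ 0) :
    ⋃ r : range σ, openHull (rowUnion σ F r) ∈ orthogonalFreeUnions E (range σ) := by
  refine ⟨fun p hp q hq => ?_, fun r => openHull (rowUnion σ F r),
    fun r => geodesicallyConvex_openHull _, ?_, rfl⟩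
  · obtain ⟨⟨_, i, rfl⟩, hp⟩ := mem_iUnion.1 hp
    obtain ⟨⟨_, j, rfl⟩, hq⟩ := mem_iUnion.1 hq
    exact (h.hasInnerSign_rowUnion i j).inner_openHull_ne_zero hp hq
  · rintro ⟨_, i, rfl⟩ ⟨_, j, rfl⟩ hij
    exact h.disjoint_closure_openHull_rowUnion ν hF fun e => hij (Subtype.ext e)

theorem iUnion_ae_le_iUnion_openHull_rowUnion [Countable ι] (σ : ι → ι → ℤˣ)
    (F : ι → Set (sphere (0 : E) 1)) :
    (⋃ i, F i : Set (sphere (0 : E) 1)) ≤ᵐ[ν.toSphere]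
      (⋃ r : range σ, openHull (rowUnion σ F r) : Set (sphere (0 : E) 1)) := by
  have := (countable_range σ).to_subtype
  have hsub : ⋃ i, F i ⊆ ⋃ r : range σ, rowUnion σ F r := iUnion_subset fun i =>
    (subset_iUnion₂ (s := fun j (_ : σ j = σ i) => F j) i rfl).trans
      (subset_iUnion (fun r : range σ => rowUnion σ F r) ⟨σ i, i, rfl⟩)
  exact hsub.eventuallyLE.trans
    (Filter.EventuallyLE.countable_iUnion fun r => ae_le_openHull ν (rowUnion σ F r))

theorem IsSignMatrix.exists_mem_orthogonalFreeUnions_ae_le [Countable ι] (h : IsSignMatrix σ F) :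
    ∃ M ∈ orthogonalFreeUnions E ι, (⋃ i, F i : Set (sphere (0 : E) 1)) ≤ᵐ[ν.toSphere] M := by
  let e : {i // ν.toSphere (F i) ≠ 0} → ι := Subtype.val
  have hmem := (h.comp e).iUnion_openHull_rowUnion_mem ν Subtype.property
  exact ⟨_, orthogonalFreeUnions_subset_of_injective
      (Subtype.val_injective.comp (rangeSplitting_injective _)) hmem,
    (iUnion_ae_le_iUnion_ne_zero _ F).trans (iUnion_ae_le_iUnion_openHull_rowUnion ν _ (F ∘ e))⟩

end RowUnion

theorem theorem2_general [FiniteDimensional ℝ E] [MeasurableSpace E] [BorelSpace E]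
    (ν : Measure E) [ν.IsAddHaarMeasure] (hE : 1 < finrank ℝ E)
    (μ : Measure (sphere (0 : E) 1)) [IsFiniteMeasure μ] (hμ : μ ≪ ν.toSphere)
    (ι : Type*) [Finite ι] :
    ∃ M ∈ orthogonalFreeUnions E ι, μ M = ⨆ S ∈ orthogonalFreeUnions E ι, μ S := by
  obtain ⟨F, ⟨σ, hσ⟩, hmax⟩ := exists_isMaxOn_signedCompacts (E := E) (ι := ι) μ
  obtain ⟨M, hM, hFM⟩ := hσ.exists_mem_orthogonalFreeUnions_ae_le ν
  refine ⟨M, hM, (le_iSup₂ (f := fun S _ => μ S) M hM).antisymm (iSup₂_le fun S hS => ?_)⟩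
  obtain ⟨G, hG, hSG⟩ := exists_mem_signedCompacts_ae_le ν hE hS
  calc
    μ S ≤ μ (⋃ i, G i) := measure_mono_ae (hμ.ae_le hSG)
    _ ≤ μ (⋃ i, F i) := hmax hG
    _ ≤ μ M := measure_mono_ae (hμ.ae_le hFM)

theorem orthogonalPairFree_iff {A : Set S2} : OrthogonalPairFree A ↔ OrthogonalFree A := by
  simp only [OrthogonalPairFree, IsOrthogonalPair, OrthogonalFree,
    ← InnerProductGeometry.inner_eq_zero_iff_angle_eq_pi_div_two, ne_eq]

theorem convexClass_eq_orthogonalFreeUnions (k : ℕ) :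
    convexClass k = orthogonalFreeUnions (EuclideanSpace ℝ (Fin 3)) (Fin k) := by
  have hunions (n : ℕ) {S : Set S2} : (OrthogonalPairFree S ∧ ∃ C : Fin n → Set S2,
      (∀ i, SphericallyConvex (C i)) ∧ (∀ i j, i ≠ j → MutuallyDisjoint (C i) (C j)) ∧
        S = ⋃ i, C i) ↔ S ∈ orthogonalFreeUnions (EuclideanSpace ℝ (Fin 3)) (Fin n) := by
    simp only [orthogonalPairFree_iff, MutuallyDisjoint, ← disjoint_iff_inter_eq_empty]
    rfl
  ext S
  constructor
  · rintro ⟨hfree, n, hn, hC⟩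
    exact orthogonalFreeUnions_subset_of_injective (Fin.castLE_injective hn)
      ((hunions n).1 ⟨hfree, hC⟩)
  · intro hS
    obtain ⟨hfree, hC⟩ := (hunions k).2 hS
    exact ⟨hfree, k, le_rfl, hC⟩

instance : IsProbabilityMeasure sphereMeasure := by
  have : NeZero (volume : Measure (EuclideanSpace ℝ (Fin 3))).toSphere :=
    ⟨Measure.toSphere_ne_zero _⟩
  exact inferInstanceAs (IsProbabilityMeasure (_⁻¹ • _))

theorem sphereMeasure_absolutelyContinuous :
    sphereMeasure ≪ (volume : Measure (EuclideanSpace ℝ (Fin 3))).toSphere :=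
  Measure.smul_absolutelyContinuous

end

theorem theorem2 (k : ℕ) :
    ∃ M ∈ convexClass k, sphereMeasure M = ⨆ S ∈ convexClass k, sphereMeasure S := by
  rw [convexClass_eq_orthogonalFreeUnions]
  exact theorem2_general volume (by simp) sphereMeasure sphereMeasure_absolutelyContinuous (Fin k)
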